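/- Let $G=(V,E,c)$ be a finite connected undirected graph with at least two vertices and positive edge weights $c_e$. For a vertex $v$ let $c_v$ be the total weight of the edges joining $v$ to other vertices, and for $S\subseteq V$ let $\mathrm{vol}_G(S)=\sum_{v\in S}c_v$. Let $D$ be the diagonal matrix of the degrees $c_v$, let $L_G=D-A$ be the Laplacian, where $A$ is the weighted adjacency matrix, and let $\lambda_G$ be the smallest nonzero eigenvalue of the normalized Laplacian $D^{-1/2}L_GD^{-1/2}$. For disjoint nonempty sets $S_1,S_2\subseteq V$ let $H=G/(S_1,S_2)$ be the graph obtained from $G$ by contracting $S_1$ to a single vertex $s_1$ and $S_2$ to a single vertex $s_2$ (weights of parallel edges add up, self-loops are discarded), and let $$\mathrm{Reff}_G(S_1,S_2)=(\mathbf 1_{s_1}-\mathbf 1_{s_2})^{T}L_H^{\dagger}(\mathbf 1_{s_1}-\mathbf 1_{s_2})$$ be the effective resistance between $s_1$ and $s_2$ in $H$, where an edge of weight $c$ is a conductor of conductance $c$ and $\dagger$ denotes the Moore--Penrose pseudoinverse. Then there are disjoint nonempty sets $S_1,S_2\subseteq V$ with $$\mathrm{Reff}_G(S_1,S_2)\ \ge\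 \frac{1}{25600\,\lambda_G\,\min(\mathrm{vol}_G(S_1),\mathrm{vol}_G(S_2))}.$$ Furthermore, every pair of disjoint nonempty sets $S_1',S_2'\subseteq V$ satisfies $$\mathrm{Reff}_G(S_1',S_2')\ \le\ \frac{2}{\lambda_G\,\min(\mathrm{vol}_G(S_1'),\mathrm{vol}_G(S_2'))}.$$ -/

import Mathlib

open scoped Matrix

/-- A weighted undirected graph on `V`: `weight u v` is the (total) weight of the edge between
`u` and `v`, and it is `0` exactly if there is no such edge.  A self-loop contributes neither to
the degree of a vertex nor to the Laplacian, so the diagonal is normalised to `0`. -/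
structure WeightedGraph (V : Type*) where
  weight : V → V → ℝ
  symm : ∀ u v, weight u v = weight v u
  nonneg : ∀ u v, 0 ≤ weight u v
  loopless : ∀ v, weight v v = 0

/-- `X` is the Moore-Penrose pseudoinverse of the real matrix `M` (the four Penrose equations). -/
structure IsMoorePenroseInverse {n : Type*} [Fintype n] (M X : Matrix n n ℝ) : Prop where
  mul_mul_self : M * X * M = M
  mul_mul_inv : X * M * X = X
  symm_left : (M * X)ᵀ = M * X
  symm_right : (X * M)ᵀ = X * M

open Classical in
/-- The Moore-Penrose pseudoinverse of a real square matrix. -/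
noncomputable def pseudoinverse {n : Type*} [Fintype n] (M : Matrix n n ℝ) : Matrix n n ℝ :=
  if h : ∃ X, IsMoorePenroseInverse M X then h.choose else 0

/-- The Moore-Penrose pseudoinverse is unique. -/
theorem IsMoorePenroseInverse.unique {n : Type*} [Fintype n] {M X Y : Matrix n n ℝ}
    (hX : IsMoorePenroseInverse M X) (hY : IsMoorePenroseInverse M Y) : X = Y := by
  have h1 : M * X = M * Y := by
    calc M * X = (M * Y) * (M * X) := by rw [← mul_assoc, hY.mul_mul_self]
      _ = (M * Y)ᵀ * (M * X)ᵀ := by rw [hY.symm_left, hX.symm_left]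
      _ = (M * X * M * Y)ᵀ := by rw [← Matrix.transpose_mul]; simp only [mul_assoc]
      _ = M * Y := by rw [hX.mul_mul_self, hY.symm_left]
  have h2 : X * M = Y * M := by
    calc X * M = (X * M) * (Y * M) := by
          rw [mul_assoc, ← mul_assoc M, hY.mul_mul_self]
      _ = (X * M)ᵀ * (Y * M)ᵀ := by rw [hY.symm_right, hX.symm_right]
      _ = (Y * (M * X * M))ᵀ := by rw [← Matrix.transpose_mul]; simp only [mul_assoc]
      _ = Y * M := by rw [hX.mul_mul_self, hY.symm_right]
  calc X = X * M * X := hX.mul_mul_inv.symm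
    _ = Y * M * Y := by rw [h2, mul_assoc, h1, ← mul_assoc]
    _ = Y := hY.mul_mul_inv

/-- On symmetric matrices `pseudoinverse` is the Moore-Penrose pseudoinverse. -/
theorem isMoorePenroseInverse_pseudoinverse {n : Type*} [Fintype n] [DecidableEq n]
    {M : Matrix n n ℝ} (hM : M.IsSymm) : IsMoorePenroseInverse M (pseudoinverse M) := by
  have hex : ∃ X, IsMoorePenroseInverse M X := by
    have hH : M.IsHermitian := by
      rw [Matrix.IsHermitian, Matrix.conjTranspose_eq_transpose_of_trivial]; exact hM
    obtain ⟨U, d, hU, hMd⟩ : ∃ (U : Matrix n n ℝ) (d : n → ℝ), Uᵀ * U = 1 ∧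
        M = U * Matrix.diagonal d * Uᵀ := by
      refine ⟨hH.eigenvectorUnitary, hH.eigenvalues, ?_, ?_⟩
      · have := (Matrix.mem_unitaryGroup_iff').1 hH.eigenvectorUnitary.2
        rwa [Matrix.star_eq_conjTranspose, Matrix.conjTranspose_eq_transpose_of_trivial] at this
      · have := hH.spectral_theorem
        rw [Unitary.conjStarAlgAut_apply] at this
        rw [← Matrix.conjTranspose_eq_transpose_of_trivial, ← Matrix.star_eq_conjTranspose]
        exact this
    have key : ∀ a b : n → ℝ, (U * Matrix.diagonal a * Uᵀ) * (U * Matrix.diagonal b * Uᵀ)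
        = U * Matrix.diagonal (fun i => a i * b i) * Uᵀ := by
      intro a b
      calc _ = U * Matrix.diagonal a * (Uᵀ * U) * Matrix.diagonal b * Uᵀ := by
            simp only [mul_assoc]
        _ = _ := by rw [hU, mul_one, mul_assoc U, Matrix.diagonal_mul_diagonal]
    have tr : ∀ a : n → ℝ, (U * Matrix.diagonal a * Uᵀ)ᵀ = U * Matrix.diagonal a * Uᵀ := by
      intro a
      simp [Matrix.transpose_mul, mul_assoc]
    refine ⟨U * Matrix.diagonal (fun i => (d i)⁻¹) * Uᵀ, ?_, ?_, ?_, ?_⟩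
    · rw [hMd, key, key]; simp [mul_inv_mul_cancel]
    · have h : ∀ x : ℝ, x⁻¹ * x * x⁻¹ = x⁻¹ := fun x => by
        by_cases hx : x = 0
        · simp [hx]
        · field_simp
      rw [hMd, key, key]
      simp only [h]
    · rw [hMd, key, tr]
    · rw [hMd, key, tr]
  rw [pseudoinverse, dif_pos hex]
  exact hex.choose_spec

namespace WeightedGraph

/-- The simple graph formed by the edges of positive weight. -/
def support {V : Type*} (G : WeightedGraph V) : SimpleGraph V where
  Adj u v := 0 < G.weight u v
  symm := ⟨fun u v h => by rw [G.symm v u]; exact h⟩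
  loopless := ⟨fun v h => by rw [G.loopless v] at h; exact lt_irrefl _ h⟩

/-- A weighted graph is connected if its edges of positive weight connect all its vertices. -/
def Connected {V : Type*} (G : WeightedGraph V) : Prop := G.support.Connected

/-- The weighted degree of a vertex. -/
def degree {V : Type*} [Fintype V] (G : WeightedGraph V) (v : V) : ℝ := ∑ u, G.weight v u

/-- The volume of a set of vertices: the sum of their weighted degrees. -/
def vol {V : Type*} [Fintype V] (G : WeightedGraph V) (A : Finset V) : ℝ := ∑ v ∈ A, G.degree v

/-- The Laplacian matrix `L = D - A`. -/
def laplacian {V : Type*} [Fintype V] [DecidableEq V] (G : WeightedGraph V) : Matrix V V ℝ :=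
  Matrix.diagonal G.degree - Matrix.of G.weight

/-- The normalized Laplacian matrix `N = D^(-1/2) L D^(-1/2)`. -/
noncomputable def normalizedLaplacian {V : Type*} [Fintype V] [DecidableEq V]
    (G : WeightedGraph V) : Matrix V V ℝ :=
  Matrix.diagonal (fun v => (Real.sqrt (G.degree v))⁻¹) * G.laplacian *
    Matrix.diagonal (fun v => (Real.sqrt (G.degree v))⁻¹)

/-- The set of nonzero eigenvalues of the normalized Laplacian. -/
def nonzeroEigenvalues {V : Type*} [Fintype V] [DecidableEq V] (G : WeightedGraph V) : Set ℝ :=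
  {μ | μ ≠ 0 ∧ Module.End.HasEigenvalue (Matrix.toLin' G.normalizedLaplacian) μ}

/-- `λ_G`: the smallest nonzero eigenvalue of the normalized Laplacian. -/
noncomputable def lam {V : Type*} [Fintype V] [DecidableEq V] (G : WeightedGraph V) : ℝ :=
  sInf G.nonzeroEigenvalues

/-- The vertices of `G/(A,B)`: the vertices outside `A ∪ B`, and two new vertices
`a = Sum.inl false` and `b = Sum.inl true`. -/
abbrev ContractedVertex {V : Type*} (A B : Finset V) : Type _ :=
  Bool ⊕ {v : V // v ∉ A ∧ v ∉ B}

/-- The map that sends `A` to `a`, `B` to `b`, and every other vertex to itself. -/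
def contractMap {V : Type*} [DecidableEq V] (A B : Finset V) (v : V) : ContractedVertex A B :=
  if hA : v ∈ A then Sum.inl false
  else if hB : v ∈ B then Sum.inl true
  else Sum.inr ⟨v, hA, hB⟩

/-- The graph `G/(A,B)`: every edge `{u, v}` of `G` becomes an edge `{f u, f v}`; the weights
(conductances) of parallel edges add up and self-loops are dropped. -/
def contract {V : Type*} [Fintype V] [DecidableEq V] (G : WeightedGraph V) (A B : Finset V) :
    WeightedGraph (ContractedVertex A B) where
  weight p q := if p = q then 0 else
    ∑ u, ∑ v, if contractMap A B u = p ∧ contractMap A B v = q then G.weight u v else 0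
  symm p q := by
    by_cases h : p = q
    · rw [h]
    · rw [if_neg h, if_neg (Ne.symm h), Finset.sum_comm]
      refine Finset.sum_congr rfl fun u _ => Finset.sum_congr rfl fun v _ => ?_
      simp only [G.symm v u, and_comm]
  nonneg p q := by
    split_ifs
    · exact le_rfl
    · refine Finset.sum_nonneg fun u _ => Finset.sum_nonneg fun v _ => ?_
      split_ifs
      · exact G.nonneg u v
      · exact le_rfl
  loopless p := if_pos rfl

/-- The effective resistance between two vertices, `χ_stᵀ L† χ_st` with `χ_st = 1_s - 1_t`. -/
noncomputable def effectiveResistance {V : Type*} [Fintype V] [DecidableEq V]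
    (G : WeightedGraph V) (s t : V) : ℝ :=
  (Pi.single s 1 - Pi.single t 1 : V → ℝ) ⬝ᵥ
    (pseudoinverse G.laplacian *ᵥ (Pi.single s 1 - Pi.single t 1 : V → ℝ))

/-- `Reff_G(A, B)`: the effective resistance between `a` and `b` in `G/(A,B)`. -/
noncomputable def Reff {V : Type*} [Fintype V] [DecidableEq V] (G : WeightedGraph V)
    (A B : Finset V) : ℝ :=
  (G.contract A B).effectiveResistance (Sum.inl false) (Sum.inl true)

theorem laplacian_isSymm {V : Type*} [Fintype V] [DecidableEq V] (G : WeightedGraph V) :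
    G.laplacian.IsSymm := by
  ext u v
  by_cases h : u = v
  · subst h; rfl
  · simp [laplacian, Matrix.diagonal_apply_ne _ h, Matrix.diagonal_apply_ne' _ h, G.symm u v]

/-- In a connected graph with at least two vertices every degree is positive. -/
theorem degree_pos {V : Type*} [Fintype V] [Nontrivial V] (G : WeightedGraph V)
    (hG : G.Connected) (v : V) : 0 < G.degree v := by
  obtain ⟨u, hu⟩ := hG.preconnected.exists_adj_of_nontrivial v
  exact Finset.sum_pos' (fun w _ => G.nonneg v w) ⟨u, Finset.mem_univ u, hu⟩

/-- In a connected graph with at least two vertices, `λ_G` is indeed the least nonzero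
eigenvalue. -/
theorem isLeast_lam {V : Type*} [Fintype V] [DecidableEq V] [Nontrivial V]
    (G : WeightedGraph V) (hG : G.Connected) : IsLeast G.nonzeroEigenvalues G.lam := by
  have hfin : G.nonzeroEigenvalues.Finite :=
    (Module.End.finite_hasEigenvalue (Matrix.toLin' G.normalizedLaplacian)).subset fun _ h => h.2
  have hH : G.normalizedLaplacian.IsHermitian := by
    rw [Matrix.IsHermitian, Matrix.conjTranspose_eq_transpose_of_trivial, normalizedLaplacian,
      Matrix.transpose_mul, Matrix.transpose_mul, G.laplacian_isSymm.eq,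
      Matrix.diagonal_transpose, mul_assoc]
  have hne : G.normalizedLaplacian ≠ 0 := by
    intro h
    obtain ⟨v⟩ : Nonempty V := inferInstance
    have h1 := congrFun (congrFun h v) v
    have hd := G.degree_pos hG v
    rw [normalizedLaplacian, Matrix.mul_diagonal, Matrix.diagonal_mul] at h1
    simp [laplacian, G.loopless, hd.ne', (Real.sqrt_pos.2 hd).ne'] at h1
  have hnon : G.nonzeroEigenvalues.Nonempty := by
    obtain ⟨v, t, ht, hv, hvt⟩ := hH.exists_eigenvector_of_ne_zero hne
    refine ⟨t, ht, Module.End.hasEigenvalue_of_hasEigenvector (x := v) ⟨?_, hv⟩⟩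
    rw [Module.End.mem_eigenspace_iff, Matrix.toLin'_apply, hvt]
  exact ⟨hnon.csInf_mem hfin, fun _ h => csInf_le hfin.bddBelow h⟩

end WeightedGraph

/-
The energy of the electrical potential of a unit current is its potential drop, the effective
resistance `R`, and Dirichlet's principle says that every function with drop `d` has energy at
least `d ^ 2 / R`. A function on `V` that is constant on `A` and on `B` is the same as a function
on `G/(A,B)`, with the same energy.

Upper bound: the potential has energy `R` and drop `R`, so it lies at squared distance at least
`min (vol A) (vol B) * R ^ 2 / 2` from every constant, and the Poincaré inequality for `λ_G`
applies.

Lower bound: the positive part `g` of a `λ_G`-eigenfunction `f` has Rayleigh quotient at most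
`λ_G`, and after replacing `f` by `-f` its support has at most as much volume as its zero set. Cut
`g` into the bands between the consecutive levels `t / 2`, `t` with `t = max g / 2 ^ k`. The
energies of the bands add up to at most the energy of `g`, while the squared norm of `g` is at
most the sum of `4 * t ^ 2 * vol {g ≥ t}`, so some band has energy at most
`4 * λ_G * t ^ 2 * vol {g ≥ t}`. Dirichlet's principle for this band, whose drop is `t / 2`, bounds
the resistance between `{g ≥ t}` and `{g ≤ t / 2}` from below.
-/

section SpectralGap

open scoped InnerProductSpace

variable {𝕜 E : Type*} [RCLike 𝕜] [NormedAddCommGroup E] [InnerProductSpace 𝕜 E]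
  [FiniteDimensional 𝕜 E]

theorem mul_norm_sub_starProjection_ker_sq_le_re_inner {T : E →ₗ[𝕜] E} (hT : T.IsSymmetric)
    {l : ℝ} (hl : ∀ μ : ℝ, μ ≠ 0 → Module.End.HasEigenvalue T (μ : 𝕜) → l ≤ μ) (x : E) :
    l * ‖x - T.ker.starProjection x‖ ^ 2 ≤ RCLike.re ⟪x, T x⟫_𝕜 := by
  set b := hT.eigenvectorBasis rfl
  set d := hT.eigenvalues rfl
  set p := T.ker.starProjection x
  have hTb (i) : T (b i) = (d i : 𝕜) • b i := hT.apply_eigenvectorBasis rfl i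
  have inner_T (i) (y : E) : ⟪b i, T y⟫_𝕜 = d i * ⟪b i, y⟫_𝕜 := by
    rw [← hT, hTb, inner_smul_left, RCLike.conj_ofReal]
  have hquad : RCLike.re ⟪x, T x⟫_𝕜 = ∑ i, d i * ‖⟪b i, x⟫_𝕜‖ ^ 2 := by
    rw [← b.sum_inner_mul_inner, map_sum]
    refine Finset.sum_congr rfl fun i _ => ?_
    rw [inner_T, mul_left_comm, ← inner_conj_symm x, RCLike.conj_mul, ← RCLike.ofReal_pow,
      ← RCLike.ofReal_mul, RCLike.ofReal_re]
  rw [hquad, ← b.sum_sq_norm_inner_right, Finset.mul_sum]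
  refine Finset.sum_le_sum fun i _ => ?_
  by_cases hi : d i = 0
  · have hb : b i ∈ T.ker := by rw [LinearMap.mem_ker, hTb, hi, RCLike.ofReal_zero, zero_smul]
    have hxp : ⟪b i, x - p⟫_𝕜 = 0 := T.ker.sub_starProjection_mem_orthogonal x _ hb
    simp [hxp, hi]
  · have hp0 : ⟪b i, p⟫_𝕜 = 0 := by
      have hTp : T p = 0 := T.ker.starProjection_apply_mem x
      simpa [hTp, hi] using (inner_T i p).symm
    rw [inner_sub_right, hp0, sub_zero]
    exact mul_le_mul_of_nonneg_right (hl _ hi (hT.hasEigenvalue_eigenvalues rfl i)) (sq_nonneg _)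

end SpectralGap

theorem hasEigenvalue_toLpLin_iff {𝕜 n : Type*} [RCLike 𝕜] [Fintype n] [DecidableEq n]
    (p : ENNReal) {M : Matrix n n 𝕜} {μ : 𝕜} :
    Module.End.HasEigenvalue (M.toLpLin p p) μ ↔ Module.End.HasEigenvalue M.toLin' μ := by
  simp only [Module.End.hasEigenvalue_iff_mem_spectrum, Matrix.spectrum_toLpLin,
    Matrix.spectrum_toLin']

theorem isSymm_pseudoinverse {n : Type*} [Fintype n] {M : Matrix n n ℝ} (hM : M.IsSymm) :
    (pseudoinverse M).IsSymm := by
  classical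
  have hP := isMoorePenroseInverse_pseudoinverse hM
  refine IsMoorePenroseInverse.unique ⟨?_, ?_, ?_, ?_⟩ hP
  · simpa [Matrix.transpose_mul, hM.eq, mul_assoc] using congrArg Matrix.transpose hP.mul_mul_self
  · simpa [Matrix.transpose_mul, hM.eq, mul_assoc] using congrArg Matrix.transpose hP.mul_mul_inv
  · simpa [Matrix.transpose_mul, hM.eq] using hP.symm_right.symm
  · simpa [Matrix.transpose_mul, hM.eq] using hP.symm_left.symm

theorem sq_posPart_sub_posPart_le (a b : ℝ) : (a⁺ - b⁺) ^ 2 ≤ (a⁺ - b⁺) * (a - b) := by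
  rcases le_total a 0 with ha | ha <;> rcases le_total b 0 with hb | hb <;>
    simp only [posPart_of_nonneg, posPart_of_nonpos, ha, hb] <;> nlinarith

/-- The part of `a` between the levels `s` and `t`: for `s ≤ t` it vanishes for `a ≤ s`, has
slope `1` between `s` and `t`, and is constantly `t - s` for `t ≤ a`. -/
def band (s t a : ℝ) : ℝ := min a t - min a s

section Band

variable {s t a b : ℝ}

theorem band_eq_zero (hst : s ≤ t) (ha : a ≤ s) : band s t a = 0 := by
  rw [band, min_eq_left (ha.trans hst), min_eq_left ha, sub_self]

theorem band_eq_sub (hst : s ≤ t) (ha : t ≤ a) : band s t a = t - s := by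
  rw [band, min_eq_right ha, min_eq_right (hst.trans ha)]

theorem monotone_band (hst : s ≤ t) : Monotone (band s t) := by
  intro a b hab
  rw [band, band]
  grind

theorem band_sub_band_le (hab : a ≤ b) : band s t b - band s t a ≤ b - a := by
  rw [band, band]
  grind

theorem sum_range_band (T : ℕ → ℝ) (n : ℕ) (a : ℝ) :
    ∑ k ∈ Finset.range n, band (T (k + 1)) (T k) a = band (T n) (T 0) a :=
  Finset.sum_range_sub' (fun k => min a (T k)) n

theorem sum_range_sq_band_sub_le {T : ℕ → ℝ} (hT : Antitone T) (n : ℕ) (a b : ℝ) :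
    ∑ k ∈ Finset.range n, (band (T (k + 1)) (T k) a - band (T (k + 1)) (T k) b) ^ 2
      ≤ (a - b) ^ 2 := by
  wlog hab : b ≤ a generalizing a b
  · simpa only [sub_sq_comm] using this b a (le_of_not_ge hab)
  have hnonneg : ∀ k, 0 ≤ band (T (k + 1)) (T k) a - band (T (k + 1)) (T k) b :=
    fun k => sub_nonneg.2 (monotone_band (hT k.le_succ) hab)
  refine (Finset.sum_sq_le_sq_sum_of_nonneg fun k _ => hnonneg k).trans
    (pow_le_pow_left₀ (Finset.sum_nonneg fun k _ => hnonneg k) ?_ 2)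
  rw [Finset.sum_sub_distrib, sum_range_band, sum_range_band]
  exact band_sub_band_le hab

end Band

theorem exists_div_two_pow_le {M a : ℝ} (ha : 0 < a) (haM : a ≤ M) :
    ∃ k : ℕ, M / 2 ^ k ≤ a ∧ a ≤ 2 * (M / 2 ^ k) := by
  obtain ⟨k, hk, hk'⟩ := exists_nat_pow_near ((one_le_div ha).2 haM) one_lt_two
  rw [le_div_iff₀' ha] at hk
  rw [div_lt_iff₀' ha] at hk'
  refine ⟨k + 1, (div_le_iff₀ (by positivity)).2 hk'.le, ?_⟩
  rw [pow_succ, ← div_div, mul_div_cancel₀ _ two_ne_zero, le_div_iff₀ (by positivity)]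
  exact hk

namespace WeightedGraph

variable {V : Type*}

section ContractMap

variable [DecidableEq V] {A B : Finset V}

theorem contractMap_of_mem_left {v : V} (hv : v ∈ A) :
    contractMap A B v = Sum.inl false :=
  dif_pos hv

theorem contractMap_of_mem_right (hAB : Disjoint A B) {v : V} (hv : v ∈ B) :
    contractMap A B v = Sum.inl true := by
  rw [contractMap, dif_neg (Finset.disjoint_right.1 hAB hv), dif_pos hv]

theorem contractMap_of_notMem {v : V} (hvA : v ∉ A) (hvB : v ∉ B) :
    contractMap A B v = Sum.inr ⟨v, hvA, hvB⟩ := by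
  rw [contractMap, dif_neg hvA, dif_neg hvB]

theorem contractMap_surjective (hA : A.Nonempty) (hB : B.Nonempty) (hAB : Disjoint A B) :
    Function.Surjective (contractMap A B) := by
  rintro ((_ | _) | ⟨v, hvA, hvB⟩)
  · exact hA.imp fun v hv => contractMap_of_mem_left hv
  · exact hB.imp fun v hv => contractMap_of_mem_right hAB hv
  · exact ⟨v, contractMap_of_notMem hvA hvB⟩

theorem exists_comp_contractMap_eq (hAB : Disjoint A B) {f : V → ℝ} {a b : ℝ}
    (hfA : ∀ v ∈ A, f v = a) (hfB : ∀ v ∈ B, f v = b) :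
    ∃ φ : ContractedVertex A B → ℝ,
      φ (Sum.inl false) = a ∧ φ (Sum.inl true) = b ∧ φ ∘ contractMap A B = f := by
  refine ⟨Sum.elim (fun i => if i then b else a) fun v => f v, rfl, rfl, funext fun v => ?_⟩
  rw [Function.comp_apply]
  by_cases hvA : v ∈ A
  · rw [contractMap_of_mem_left hvA, hfA v hvA]; rfl
  by_cases hvB : v ∈ B
  · rw [contractMap_of_mem_right hAB hvB, hfB v hvB]; rfl
  · rw [contractMap_of_notMem hvA hvB]; rfl

end ContractMap

variable [Fintype V] {G : WeightedGraph V}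

theorem degree_nonneg (G : WeightedGraph V) (v : V) : 0 ≤ G.degree v :=
  Finset.sum_nonneg fun u _ => G.nonneg v u

theorem vol_mono (G : WeightedGraph V) {A B : Finset V} (h : A ⊆ B) : G.vol A ≤ G.vol B :=
  Finset.sum_le_sum_of_subset_of_nonneg h fun v _ _ => G.degree_nonneg v

theorem vol_pos (hdeg : ∀ v, 0 < G.degree v) {A : Finset V} (hA : A.Nonempty) : 0 < G.vol A :=
  Finset.sum_pos (fun v _ => hdeg v) hA

/-- The squared norm of `f` in the weighted space `ℓ²(V, c)`, where the vertex `v` has mass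
`c_v`; it is the denominator of the Rayleigh quotients for `λ_G`. -/
def degreeNormSq (G : WeightedGraph V) (f : V → ℝ) : ℝ := ∑ v, G.degree v * f v ^ 2

theorem degreeNormSq_pos (hdeg : ∀ v, 0 < G.degree v) {f : V → ℝ} (hf : f ≠ 0) :
    0 < G.degreeNormSq f := by
  obtain ⟨w, hw⟩ := Function.ne_iff.1 hf
  exact Finset.sum_pos' (fun v _ => mul_nonneg (G.degree_nonneg v) (sq_nonneg _))
    ⟨w, Finset.mem_univ w, mul_pos (hdeg w) (sq_pos_of_ne_zero hw)⟩

theorem min_vol_mul_sq_sub_le_degreeNormSq (G : WeightedGraph V) {A B : Finset V}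
    (hAB : Disjoint A B) {f : V → ℝ} {a b : ℝ} (hfA : ∀ v ∈ A, f v = a)
    (hfB : ∀ v ∈ B, f v = b) :
    min (G.vol A) (G.vol B) * (a - b) ^ 2 ≤ 2 * G.degreeNormSq f := by
  have hA : ∑ v ∈ A, G.degree v * f v ^ 2 = G.vol A * a ^ 2 := by
    rw [vol, Finset.sum_mul]
    exact Finset.sum_congr rfl fun v hv => by rw [hfA v hv]
  have hB : ∑ v ∈ B, G.degree v * f v ^ 2 = G.vol B * b ^ 2 := by
    rw [vol, Finset.sum_mul]
    exact Finset.sum_congr rfl fun v hv => by rw [hfB v hv]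
  have hmin : 0 ≤ min (G.vol A) (G.vol B) :=
    le_min (Finset.sum_nonneg fun v _ => G.degree_nonneg v)
      (Finset.sum_nonneg fun v _ => G.degree_nonneg v)
  calc min (G.vol A) (G.vol B) * (a - b) ^ 2
      ≤ min (G.vol A) (G.vol B) * (2 * (a ^ 2 + b ^ 2)) := by
        gcongr
        nlinarith [sq_nonneg (a + b)]
    _ = 2 * (min (G.vol A) (G.vol B) * a ^ 2 + min (G.vol A) (G.vol B) * b ^ 2) := by ring
    _ ≤ 2 * (G.vol A * a ^ 2 + G.vol B * b ^ 2) := by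
        gcongr
        exacts [min_le_left _ _, min_le_right _ _]
    _ = 2 * ∑ v ∈ A.disjUnion B hAB, G.degree v * f v ^ 2 := by
        rw [Finset.sum_disjUnion, hA, hB]
    _ ≤ 2 * G.degreeNormSq f := by
        gcongr
        exact Finset.sum_le_univ_sum_of_nonneg fun v =>
          mul_nonneg (G.degree_nonneg v) (sq_nonneg _)

/-- The Dirichlet energy of a function on the vertices: the power dissipated when `f` is the
electrical potential. The sum runs over ordered pairs, hence the division by `2`. -/
noncomputable def energy (G : WeightedGraph V) (f : V → ℝ) : ℝ :=
  (∑ u, ∑ v, G.weight u v * (f u - f v) ^ 2) / 2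

theorem energy_nonneg (G : WeightedGraph V) (f : V → ℝ) : 0 ≤ G.energy f :=
  div_nonneg (Finset.sum_nonneg fun u _ => Finset.sum_nonneg fun v _ =>
    mul_nonneg (G.nonneg u v) (sq_nonneg _)) two_pos.le

theorem Connected.eq_of_energy_eq_zero (hG : G.Connected) {f : V → ℝ} (hf : G.energy f = 0)
    (u v : V) : f u = f v := by
  have hnonneg (u v) : 0 ≤ G.weight u v * (f u - f v) ^ 2 :=
    mul_nonneg (G.nonneg u v) (sq_nonneg _)
  have hzero (u v) : G.weight u v * (f u - f v) ^ 2 = 0 := by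
    have hsum : ∑ u, ∑ v, G.weight u v * (f u - f v) ^ 2 = 0 :=
      (div_eq_zero_iff.1 hf).resolve_right two_ne_zero
    simp_rw [Finset.sum_eq_zero_iff_of_nonneg fun _ _ => Finset.sum_nonneg fun _ _ => hnonneg _ _,
      Finset.sum_eq_zero_iff_of_nonneg fun _ _ => hnonneg _ _] at hsum
    exact hsum u (Finset.mem_univ u) v (Finset.mem_univ v)
  obtain ⟨p⟩ := hG.preconnected u v
  induction p with
  | nil => rfl
  | cons hadj _ ih =>
    have hsq := (mul_eq_zero.1 (hzero _ _)).resolve_left (ne_of_gt hadj)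
    exact (sub_eq_zero.1 (sq_eq_zero_iff.1 hsq)).trans ih

theorem sum_energy_band_le (G : WeightedGraph V) {T : ℕ → ℝ} (hT : Antitone T) (n : ℕ)
    (g : V → ℝ) : ∑ k ∈ Finset.range n, G.energy (band (T (k + 1)) (T k) ∘ g) ≤ G.energy g := by
  simp only [energy, Function.comp_apply]
  rw [← Finset.sum_div, Finset.sum_comm]
  simp only [Finset.sum_comm (s := Finset.range n), ← Finset.mul_sum]
  gcongr with u _ v _
  · exact G.nonneg u v
  · exact sum_range_sq_band_sub_le hT n _ _

theorem exists_degreeNormSq_le_sum_dyadic_vol (G : WeightedGraph V) {g : V → ℝ} {M : ℝ}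
    (hg : 0 ≤ g) (hgM : ∀ v, g v ≤ M) :
    ∃ n : ℕ, G.degreeNormSq g ≤
      ∑ k ∈ Finset.range (n + 1), 4 * (M / 2 ^ k) ^ 2 * G.vol {v | M / 2 ^ k ≤ g v} := by
  have hlevel (v) : ∃ k : ℕ, 0 < g v → M / 2 ^ k ≤ g v ∧ g v ≤ 2 * (M / 2 ^ k) := by
    by_cases hv : 0 < g v
    · exact (exists_div_two_pow_le hv (hgM v)).imp fun k hk _ => hk
    · exact ⟨0, fun h => absurd h hv⟩
  choose K hK using hlevel
  refine ⟨Finset.univ.sup K, ?_⟩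
  have hsq (v) : g v ^ 2 ≤ ∑ k ∈ Finset.range (Finset.univ.sup K + 1),
      if M / 2 ^ k ≤ g v then 4 * (M / 2 ^ k) ^ 2 else 0 := by
    have hterm (k : ℕ) : 0 ≤ if M / 2 ^ k ≤ g v then 4 * (M / 2 ^ k) ^ 2 else 0 := by
      split_ifs <;> positivity
    rcases (hg v).eq_or_lt' with hv | hv
    · rw [hv]
      simpa [hv] using Finset.sum_nonneg fun k _ => hterm k
    · have hKv : K v ∈ Finset.range (Finset.univ.sup K + 1) :=
        Finset.mem_range_succ_iff.2 (Finset.le_sup (Finset.mem_univ v))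
      refine le_trans ?_ (Finset.single_le_sum (fun k _ => hterm k) hKv)
      rw [if_pos (hK v hv).1]
      exact (pow_le_pow_left₀ (hg v) (hK v hv).2 2).trans_eq (by ring)
  calc G.degreeNormSq g
      ≤ ∑ v, G.degree v * ∑ k ∈ Finset.range (Finset.univ.sup K + 1),
          if M / 2 ^ k ≤ g v then 4 * (M / 2 ^ k) ^ 2 else 0 :=
        Finset.sum_le_sum fun v _ => mul_le_mul_of_nonneg_left (hsq v) (G.degree_nonneg v)
    _ = _ := by
        simp only [Finset.mul_sum, vol, Finset.sum_filter, mul_ite, mul_zero]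
        rw [Finset.sum_comm]
        simp only [mul_comm]

theorem exists_band_energy_le (G : WeightedGraph V) {l : ℝ} (hl : 0 ≤ l) {g : V → ℝ}
    (hg : 0 ≤ g) (hne : g ≠ 0) (hE : G.energy g ≤ l * G.degreeNormSq g) :
    ∃ t, 0 < t ∧ (∃ v, t ≤ g v) ∧
      G.energy (band (t / 2) t ∘ g) ≤ 4 * l * t ^ 2 * G.vol {v | t ≤ g v} := by
  obtain ⟨w, hw⟩ := Function.ne_iff.1 hne
  obtain ⟨m, -, hm⟩ := Finset.exists_max_image Finset.univ g ⟨w, Finset.mem_univ w⟩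
  have hM : 0 < g m := ((hg w).lt_of_ne' hw).trans_le (hm w (Finset.mem_univ w))
  obtain ⟨n, hn⟩ := G.exists_degreeNormSq_le_sum_dyadic_vol hg fun v => hm v (Finset.mem_univ v)
  set T : ℕ → ℝ := fun k => g m / 2 ^ k with hT
  have hT_half (k) : T (k + 1) = T k / 2 := by simp only [hT, pow_succ, div_div]
  have hT_pos (k) : 0 < T k := by positivity
  have hT_anti : Antitone T := antitone_nat_of_succ_le fun k => by
    rw [hT_half]
    exact half_le_self (hT_pos k).le
  have hsum : ∑ k ∈ Finset.range (n + 1), G.energy (band (T (k + 1)) (T k) ∘ g) ≤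
      ∑ k ∈ Finset.range (n + 1), l * (4 * T k ^ 2 * G.vol {v | T k ≤ g v}) := by
    rw [← Finset.mul_sum]
    exact (G.sum_energy_band_le hT_anti _ g).trans (hE.trans (mul_le_mul_of_nonneg_left hn hl))
  obtain ⟨k, -, hk⟩ := Finset.exists_le_of_sum_le Finset.nonempty_range_add_one hsum
  refine ⟨T k, hT_pos k, ⟨m, div_le_self hM.le (one_le_pow₀ one_le_two)⟩, ?_⟩
  rw [← hT_half]
  exact hk.trans_eq (by ring)

variable [DecidableEq V]

theorem laplacian_mulVec (G : WeightedGraph V) (f : V → ℝ) (u : V) :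
    (G.laplacian *ᵥ f) u = ∑ v, G.weight u v * (f u - f v) := by
  rw [laplacian, Matrix.sub_mulVec, Pi.sub_apply, Matrix.mulVec_diagonal, degree]
  simp only [Matrix.mulVec, dotProduct, Matrix.of_apply, mul_sub, Finset.sum_sub_distrib,
    Finset.sum_mul]

theorem dotProduct_laplacian_mulVec (G : WeightedGraph V) (g f : V → ℝ) :
    g ⬝ᵥ (G.laplacian *ᵥ f) =
      (∑ u, ∑ v, G.weight u v * ((g u - g v) * (f u - f v))) / 2 := by
  have h : g ⬝ᵥ (G.laplacian *ᵥ f) = ∑ u, ∑ v, G.weight u v * (g u * (f u - f v)) := by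
    simp only [dotProduct, laplacian_mulVec, Finset.mul_sum, mul_left_comm]
  have hswap : g ⬝ᵥ (G.laplacian *ᵥ f) = ∑ u, ∑ v, G.weight u v * (g v * (f v - f u)) := by
    rw [h, Finset.sum_comm]
    simp only [G.symm]
  rw [eq_div_iff two_ne_zero, mul_two]
  nth_rw 1 [h]
  simp only [hswap, ← Finset.sum_add_distrib]
  exact Finset.sum_congr rfl fun u _ => Finset.sum_congr rfl fun v _ => by ring

theorem dotProduct_laplacian_mulVec_self (G : WeightedGraph V) (f : V → ℝ) :
    f ⬝ᵥ (G.laplacian *ᵥ f) = G.energy f := by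
  simp only [dotProduct_laplacian_mulVec, energy, sq]

theorem sq_dotProduct_laplacian_mulVec_le (G : WeightedGraph V) (g f : V → ℝ) :
    (g ⬝ᵥ (G.laplacian *ᵥ f)) ^ 2 ≤ G.energy g * G.energy f := by
  have h := LinearMap.BilinForm.apply_sq_le_of_symm (Matrix.toBilin' G.laplacian)
    (fun f => by
      rw [Matrix.toBilin'_apply', dotProduct_laplacian_mulVec_self]
      exact G.energy_nonneg f)
    ⟨fun g f => by
      simp only [Matrix.toBilin'_apply', dotProduct_laplacian_mulVec, mul_comm, RingHom.id_apply]⟩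
    g f
  simpa only [Matrix.toBilin'_apply', dotProduct_laplacian_mulVec_self] using h

theorem energy_posPart_le (G : WeightedGraph V) (f : V → ℝ) :
    G.energy f⁺ ≤ f⁺ ⬝ᵥ (G.laplacian *ᵥ f) := by
  rw [dotProduct_laplacian_mulVec, energy]
  gcongr with u _ v _
  · exact G.nonneg u v
  · exact sq_posPart_sub_posPart_le (f u) (f v)

theorem sum_laplacian_mulVec (G : WeightedGraph V) (f : V → ℝ) :
    ∑ v, (G.laplacian *ᵥ f) v = 0 := by
  simpa [dotProduct] using G.dotProduct_laplacian_mulVec 1 f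

theorem normalizedLaplacian_isHermitian (G : WeightedGraph V) :
    G.normalizedLaplacian.IsHermitian := by
  rw [Matrix.IsHermitian, Matrix.conjTranspose_eq_transpose_of_trivial, normalizedLaplacian,
    Matrix.transpose_mul, Matrix.transpose_mul, G.laplacian_isSymm.eq,
    Matrix.diagonal_transpose, mul_assoc]

theorem normalizedLaplacian_mulVec (G : WeightedGraph V) (x : V → ℝ) (v : V) :
    (G.normalizedLaplacian *ᵥ x) v =
      (√(G.degree v))⁻¹ * (G.laplacian *ᵥ fun u => (√(G.degree u))⁻¹ * x u) v := by
  rw [normalizedLaplacian, ← Matrix.mulVec_mulVec, ← Matrix.mulVec_mulVec, Matrix.mulVec_diagonal]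
  congr 3
  exact funext fun u => Matrix.mulVec_diagonal _ x u

theorem dotProduct_normalizedLaplacian_mulVec_self (G : WeightedGraph V) (x : V → ℝ) :
    x ⬝ᵥ (G.normalizedLaplacian *ᵥ x) = G.energy fun u => (√(G.degree u))⁻¹ * x u := by
  rw [← dotProduct_laplacian_mulVec_self]
  refine Finset.sum_congr rfl fun v _ => ?_
  rw [normalizedLaplacian_mulVec, mul_left_comm, mul_assoc]

/-- `f` is an eigenfunction of the generalized eigenvalue problem `L f = μ D f`. It corresponds to
the eigenvector `D^(1/2) f` of the normalized Laplacian. -/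
structure IsEigenfunction (G : WeightedGraph V) (μ : ℝ) (f : V → ℝ) : Prop where
  ne_zero : f ≠ 0
  laplacian_mulVec (v : V) : (G.laplacian *ᵥ f) v = μ * (G.degree v * f v)

theorem exists_isEigenfunction (hdeg : ∀ v, 0 < G.degree v) {μ : ℝ}
    (hμ : Module.End.HasEigenvalue G.normalizedLaplacian.toLin' μ) :
    ∃ f, G.IsEigenfunction μ f := by
  have hsqrt (v) : √(G.degree v) ≠ 0 := (Real.sqrt_pos.2 (hdeg v)).ne'
  obtain ⟨x, hx, hx0⟩ := hμ.exists_hasEigenvector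
  rw [Module.End.mem_eigenspace_iff, Matrix.toLin'_apply] at hx
  refine ⟨fun u => (√(G.degree u))⁻¹ * x u, fun h => hx0 (funext fun v => ?_), fun v => ?_⟩
  · exact (mul_eq_zero.1 (congrFun h v)).resolve_left (inv_ne_zero (hsqrt v))
  · have hxv := congrFun hx v
    rw [normalizedLaplacian_mulVec, Pi.smul_apply, smul_eq_mul,
      inv_mul_eq_iff_eq_mul₀ (hsqrt v)] at hxv
    have hdeg_v : G.degree v * (√(G.degree v))⁻¹ = √(G.degree v) := by
      rw [← div_eq_mul_inv, Real.div_sqrt]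
    rw [hxv, ← mul_assoc (G.degree v), hdeg_v, mul_left_comm]

namespace IsEigenfunction

variable {μ : ℝ} {f : V → ℝ}

theorem neg (hf : G.IsEigenfunction μ f) : G.IsEigenfunction μ (-f) where
  ne_zero := neg_ne_zero.2 hf.ne_zero
  laplacian_mulVec v := by
    rw [Matrix.mulVec_neg, Pi.neg_apply, Pi.neg_apply, hf.laplacian_mulVec, mul_neg, mul_neg]

theorem energy_eq (hf : G.IsEigenfunction μ f) : G.energy f = μ * G.degreeNormSq f := by
  rw [← dotProduct_laplacian_mulVec_self, degreeNormSq, Finset.mul_sum]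
  refine Finset.sum_congr rfl fun v _ => ?_
  rw [hf.laplacian_mulVec]
  ring

theorem eigenvalue_nonneg (hdeg : ∀ v, 0 < G.degree v) (hf : G.IsEigenfunction μ f) : 0 ≤ μ :=
  nonneg_of_mul_nonneg_left (hf.energy_eq ▸ G.energy_nonneg f) (degreeNormSq_pos hdeg hf.ne_zero)

theorem energy_posPart_le (hf : G.IsEigenfunction μ f) :
    G.energy f⁺ ≤ μ * G.degreeNormSq f⁺ := by
  refine (G.energy_posPart_le f).trans_eq ?_
  rw [degreeNormSq, Finset.mul_sum]
  refine Finset.sum_congr rfl fun v _ => ?_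
  rw [hf.laplacian_mulVec, Pi.posPart_apply]
  rcases le_total (f v) 0 with h | h
  · simp [posPart_of_nonpos h]
  · rw [posPart_of_nonneg h]
    ring

theorem sum_degree_mul (hf : G.IsEigenfunction μ f) (hμ : μ ≠ 0) :
    ∑ v, G.degree v * f v = 0 := by
  have h := G.sum_laplacian_mulVec f
  simp only [hf.laplacian_mulVec, ← Finset.mul_sum] at h
  exact (mul_eq_zero.1 h).resolve_left hμ

theorem exists_pos (hdeg : ∀ v, 0 < G.degree v) (hf : G.IsEigenfunction μ f) (hμ : μ ≠ 0) :
    ∃ v, 0 < f v := by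
  by_contra! h
  refine hf.ne_zero (funext fun v => ?_)
  have := (Finset.sum_eq_zero_iff_of_nonpos fun v _ =>
    mul_nonpos_of_nonneg_of_nonpos (G.degree_nonneg v) (h v)).1 (hf.sum_degree_mul hμ) v
      (Finset.mem_univ v)
  exact (mul_eq_zero.1 this).resolve_left (hdeg v).ne'

theorem posPart_ne_zero (hdeg : ∀ v, 0 < G.degree v) (hf : G.IsEigenfunction μ f)
    (hμ : μ ≠ 0) : f⁺ ≠ 0 := by
  obtain ⟨v, hv⟩ := hf.exists_pos hdeg hμ
  exact fun h => (posPart_pos hv).ne' (congrFun h v)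

end IsEigenfunction

section Nontrivial

variable [Nontrivial V]

theorem Connected.exists_isEigenfunction_lam (hG : G.Connected) : ∃ f, G.IsEigenfunction G.lam f :=
  exists_isEigenfunction (G.degree_pos hG) (G.isLeast_lam hG).1.2

theorem Connected.lam_pos (hG : G.Connected) : 0 < G.lam := by
  obtain ⟨f, hf⟩ := hG.exists_isEigenfunction_lam
  exact (hf.eigenvalue_nonneg (G.degree_pos hG)).lt_of_ne' (G.isLeast_lam hG).1.1

theorem Connected.exists_eq_sqrt_degree_mul (hG : G.Connected) {x : V → ℝ}
    (hx : G.normalizedLaplacian *ᵥ x = 0) : ∃ c, ∀ v, x v = √(G.degree v) * c := by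
  have henergy : G.energy (fun u => (√(G.degree u))⁻¹ * x u) = 0 := by
    rw [← dotProduct_normalizedLaplacian_mulVec_self, hx, dotProduct_zero]
  obtain ⟨w⟩ := hG.nonempty
  refine ⟨(√(G.degree w))⁻¹ * x w, fun v => ?_⟩
  rw [← hG.eq_of_energy_eq_zero henergy v w,
    mul_inv_cancel_left₀ (Real.sqrt_pos.2 (G.degree_pos hG v)).ne']

theorem Connected.exists_lam_mul_degreeNormSq_sub_le_energy (hG : G.Connected) (f : V → ℝ) :
    ∃ c : ℝ, G.lam * G.degreeNormSq (fun v => f v - c) ≤ G.energy f := by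
  have hsqrt (v) : √(G.degree v) ≠ 0 := (Real.sqrt_pos.2 (G.degree_pos hG v)).ne'
  set T := G.normalizedLaplacian.toLpLin 2 2
  set x : EuclideanSpace ℝ V := WithLp.toLp 2 fun v => √(G.degree v) * f v
  set p := T.ker.starProjection x
  have hgap : G.lam * ‖x - p‖ ^ 2 ≤ inner ℝ x (T x) :=
    mul_norm_sub_starProjection_ker_sq_le_re_inner
      (Matrix.isSymmetric_toEuclideanLin_iff.2 G.normalizedLaplacian_isHermitian)
      (fun μ hμ h => (G.isLeast_lam hG).2 ⟨hμ, (hasEigenvalue_toLpLin_iff 2).1 h⟩) x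
  have hinner : inner ℝ x (T x) = G.energy f := by
    rw [Matrix.toLpLin_toLp, EuclideanSpace.inner_toLp_toLp, star_trivial, dotProduct_comm,
      Matrix.toLin'_apply, dotProduct_normalizedLaplacian_mulVec_self]
    simp only [inv_mul_cancel_left₀ (hsqrt _)]
  have hp : G.normalizedLaplacian *ᵥ p.ofLp = 0 :=
    congrArg WithLp.ofLp (T.ker.starProjection_apply_mem x)
  obtain ⟨c, hc⟩ := hG.exists_eq_sqrt_degree_mul hp
  refine ⟨c, le_of_eq_of_le ?_ (hgap.trans_eq hinner)⟩
  rw [EuclideanSpace.real_norm_sq_eq, degreeNormSq]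
  congr! 2 with v
  rw [PiLp.sub_apply, hc, ← mul_sub, mul_pow, Real.sq_sqrt (G.degree_nonneg v)]

end Nontrivial

/-- The electrical potential of the unit current flow from `s` to `t`, normalized by the
pseudoinverse to be orthogonal to the kernel of the Laplacian. -/
noncomputable def potential (G : WeightedGraph V) (s t : V) : V → ℝ :=
  pseudoinverse G.laplacian *ᵥ (Pi.single s 1 - Pi.single t 1)

theorem dotProduct_single_sub_single (f : V → ℝ) (s t : V) :
    f ⬝ᵥ (Pi.single s 1 - Pi.single t 1) = f s - f t := by
  rw [dotProduct_sub, dotProduct_single_one, dotProduct_single_one]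

theorem effectiveResistance_eq_potential_sub (G : WeightedGraph V) (s t : V) :
    G.effectiveResistance s t = G.potential s t s - G.potential s t t := by
  rw [← dotProduct_single_sub_single, dotProduct_comm, effectiveResistance, potential]

theorem energy_potential (G : WeightedGraph V) (s t : V) :
    G.energy (G.potential s t) = G.effectiveResistance s t := by
  have hP := isMoorePenroseInverse_pseudoinverse G.laplacian_isSymm
  have hswap (χ : V → ℝ) : pseudoinverse G.laplacian *ᵥ χ = χ ᵥ* pseudoinverse G.laplacian := by
    rw [← Matrix.vecMul_transpose, (isSymm_pseudoinverse G.laplacian_isSymm).eq]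
  rw [← dotProduct_laplacian_mulVec_self, effectiveResistance, potential]
  nth_rw 1 [hswap]
  rw [← Matrix.dotProduct_mulVec, Matrix.mulVec_mulVec, Matrix.mulVec_mulVec, hP.mul_mul_inv]

theorem effectiveResistance_nonneg (G : WeightedGraph V) (s t : V) :
    0 ≤ G.effectiveResistance s t :=
  G.energy_potential s t ▸ G.energy_nonneg _

theorem Connected.laplacian_mulVec_potential (hG : G.Connected) (s t : V) :
    G.laplacian *ᵥ G.potential s t = Pi.single s 1 - Pi.single t 1 := by
  have hP := isMoorePenroseInverse_pseudoinverse G.laplacian_isSymm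
  set χ : V → ℝ := Pi.single s 1 - Pi.single t 1 with hχ
  set r := χ - G.laplacian *ᵥ G.potential s t with hr
  have hLr : G.laplacian *ᵥ r = 0 := by
    have hLLP := congrArg Matrix.transpose hP.mul_mul_self
    rw [Matrix.transpose_mul, hP.symm_left, G.laplacian_isSymm.eq] at hLLP
    rw [hr, Matrix.mulVec_sub, potential, Matrix.mulVec_mulVec, Matrix.mulVec_mulVec, mul_assoc,
      hLLP, sub_self]
  have hrχ : r ⬝ᵥ χ = 0 := by
    have henergy : G.energy r = 0 := by
      rw [← dotProduct_laplacian_mulVec_self, hLr, dotProduct_zero]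
    rw [hχ, dotProduct_single_sub_single, hG.eq_of_energy_eq_zero henergy s t, sub_self]
  have hrr : r ⬝ᵥ r = 0 := by
    nth_rw 2 [hr]
    rw [dotProduct_sub, hrχ, Matrix.dotProduct_mulVec, ← Matrix.mulVec_transpose,
      G.laplacian_isSymm.eq, hLr, zero_dotProduct, sub_zero]
  exact (sub_eq_zero.1 (dotProduct_self_eq_zero.1 hrr)).symm

theorem Connected.sq_sub_le_effectiveResistance_mul_energy (hG : G.Connected) (f : V → ℝ)
    (s t : V) : (f s - f t) ^ 2 ≤ G.effectiveResistance s t * G.energy f := by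
  have h := G.sq_dotProduct_laplacian_mulVec_le f (G.potential s t)
  rwa [hG.laplacian_mulVec_potential, dotProduct_single_sub_single, energy_potential,
    mul_comm] at h

section Contraction

variable {A B : Finset V}

theorem energy_contract (G : WeightedGraph V) (A B : Finset V) (φ : ContractedVertex A B → ℝ) :
    (G.contract A B).energy φ = G.energy (φ ∘ contractMap A B) := by
  set c := contractMap A B
  have hterm (p q : ContractedVertex A B) :
      (G.contract A B).weight p q * (φ p - φ q) ^ 2 =
        ∑ u with c u = p, ∑ v with c v = q, G.weight u v * (φ (c u) - φ (c v)) ^ 2 := by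
    have hfiber : ∑ u with c u = p, ∑ v with c v = q, G.weight u v * (φ (c u) - φ (c v)) ^ 2 =
        (∑ u with c u = p, ∑ v with c v = q, G.weight u v) * (φ p - φ q) ^ 2 := by
      simp only [Finset.sum_mul]
      refine Finset.sum_congr rfl fun u hu => Finset.sum_congr rfl fun v hv => ?_
      rw [(Finset.mem_filter.1 hu).2, (Finset.mem_filter.1 hv).2]
    rw [hfiber]
    by_cases hpq : p = q
    · simp [hpq]
    · simp [contract, hpq, Finset.sum_filter, ite_and, c]
  rw [energy, energy]
  congr 1
  calc ∑ p, ∑ q, (G.contract A B).weight p q * (φ p - φ q) ^ 2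
      = ∑ p, ∑ u with c u = p, ∑ q, ∑ v with c v = q,
          G.weight u v * (φ (c u) - φ (c v)) ^ 2 := by
        simp only [hterm]
        exact Finset.sum_congr rfl fun p _ => Finset.sum_comm
    _ = ∑ u, ∑ v, G.weight u v * (φ (c u) - φ (c v)) ^ 2 := by
        simp only [Finset.sum_fiberwise]

theorem weight_le_weight_contract (G : WeightedGraph V) {u v : V}
    (h : contractMap A B u ≠ contractMap A B v) :
    G.weight u v ≤ (G.contract A B).weight (contractMap A B u) (contractMap A B v) := by
  have hterm (u' v') : 0 ≤ if contractMap A B u' = contractMap A B u ∧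
      contractMap A B v' = contractMap A B v then G.weight u' v' else 0 := by
    split_ifs
    exacts [G.nonneg u' v', le_rfl]
  refine le_of_le_of_eq ?_ (if_neg h).symm
  refine le_trans ?_ (Finset.single_le_sum (fun u' _ => Finset.sum_nonneg fun v' _ => hterm u' v')
    (Finset.mem_univ u))
  refine le_trans ?_ (Finset.single_le_sum (fun v' _ => hterm u v') (Finset.mem_univ v))
  simp

theorem Connected.contract (hG : G.Connected) (hA : A.Nonempty) (hB : B.Nonempty)
    (hAB : Disjoint A B) : (G.contract A B).Connected := by
  refine (SimpleGraph.connected_iff _).2 ⟨fun p q => ?_, ⟨Sum.inl false⟩⟩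
  obtain ⟨u, rfl⟩ := contractMap_surjective hA hB hAB p
  obtain ⟨v, rfl⟩ := contractMap_surjective hA hB hAB q
  obtain ⟨walk⟩ := hG.preconnected u v
  induction walk with
  | nil => rfl
  | @cons u w _ hadj _ ih =>
    refine .trans ?_ ih
    by_cases h : contractMap A B u = contractMap A B w
    · rw [h]
    · exact SimpleGraph.Adj.reachable (hadj.trans_le (G.weight_le_weight_contract h))

theorem exists_energy_eq_Reff (G : WeightedGraph V) (hAB : Disjoint A B) :
    ∃ (f : V → ℝ) (a b : ℝ), (∀ v ∈ A, f v = a) ∧ (∀ v ∈ B, f v = b) ∧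
      a - b = G.Reff A B ∧ G.energy f = G.Reff A B := by
  set φ := (G.contract A B).potential (Sum.inl false) (Sum.inl true)
  refine ⟨φ ∘ contractMap A B, φ (Sum.inl false), φ (Sum.inl true), fun v hv => ?_,
    fun v hv => ?_, ?_, ?_⟩
  · rw [Function.comp_apply, contractMap_of_mem_left hv]
  · rw [Function.comp_apply, contractMap_of_mem_right hAB hv]
  · rw [Reff, effectiveResistance_eq_potential_sub]
  · rw [← energy_contract, energy_potential, Reff]

theorem Connected.sq_sub_le_Reff_mul_energy (hG : G.Connected) (hA : A.Nonempty)
    (hB : B.Nonempty) (hAB : Disjoint A B) {f : V → ℝ} {a b : ℝ} (hfA : ∀ v ∈ A, f v = a)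
    (hfB : ∀ v ∈ B, f v = b) : (a - b) ^ 2 ≤ G.Reff A B * G.energy f := by
  obtain ⟨φ, rfl, rfl, rfl⟩ := exists_comp_contractMap_eq hAB hfA hfB
  rw [← energy_contract]
  exact (hG.contract hA hB hAB).sq_sub_le_effectiveResistance_mul_energy φ _ _

theorem Reff_nonneg (G : WeightedGraph V) (A B : Finset V) : 0 ≤ G.Reff A B :=
  effectiveResistance_nonneg _ _ _

end Contraction

theorem IsEigenfunction.exists_energy_le_and_vol_pos_le {μ : ℝ} {f : V → ℝ}
    (hdeg : ∀ v, 0 < G.degree v) (hf : G.IsEigenfunction μ f) (hμ : μ ≠ 0) :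
    ∃ g : V → ℝ, 0 ≤ g ∧ g ≠ 0 ∧ G.energy g ≤ μ * G.degreeNormSq g ∧
      G.vol {v | 0 < g v} ≤ G.vol {v | g v = 0} := by
  have hvol {h k : V → ℝ} (hhk : ∀ v, 0 < h v → k v ≤ 0)
      (hle : G.vol {v | 0 < k v} ≤ G.vol {v | 0 < h v}) :
      G.vol {v | 0 < k⁺ v} ≤ G.vol {v | k⁺ v = 0} := by
    simp only [Pi.posPart_apply, posPart_pos_iff, posPart_eq_zero]
    exact hle.trans (G.vol_mono (Finset.monotone_filter_right _ fun v _ => hhk v))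
  rcases le_total (G.vol {v | 0 < f v}) (G.vol {v | 0 < (-f) v}) with h | h
  · exact ⟨f⁺, posPart_nonneg f, hf.posPart_ne_zero hdeg hμ, hf.energy_posPart_le,
      hvol (fun v hv => (neg_pos.1 hv).le) h⟩
  · exact ⟨(-f)⁺, posPart_nonneg _, hf.neg.posPart_ne_zero hdeg hμ, hf.neg.energy_posPart_le,
      hvol (fun v hv => neg_nonpos.2 hv.le) h⟩

theorem Connected.exists_one_le_mul_vol_mul_Reff (hG : G.Connected)
    (hdeg : ∀ v, 0 < G.degree v) {l : ℝ} (hl : 0 ≤ l) {g : V → ℝ} (hg : 0 ≤ g) (hne : g ≠ 0)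
    (hE : G.energy g ≤ l * G.degreeNormSq g)
    (hvol : G.vol {v | 0 < g v} ≤ G.vol {v | g v = 0}) :
    ∃ A B : Finset V, A.Nonempty ∧ B.Nonempty ∧ Disjoint A B ∧ G.vol A ≤ G.vol B ∧
      1 ≤ 16 * l * G.vol A * G.Reff A B := by
  obtain ⟨t, ht, ⟨w, hw⟩, hband⟩ := G.exists_band_energy_le hl hg hne hE
  set A : Finset V := {v | t ≤ g v}
  set B : Finset V := {v | g v ≤ t / 2}
  have mem_A {v} : v ∈ A ↔ t ≤ g v := Finset.mem_filter_univ v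
  have mem_B {v} : v ∈ B ↔ g v ≤ t / 2 := Finset.mem_filter_univ v
  have half_le : t / 2 ≤ t := half_le_self ht.le
  have hA : A.Nonempty := ⟨w, mem_A.2 hw⟩
  have hAB : Disjoint A B := Finset.disjoint_left.2 fun v hvA hvB =>
    (half_lt_self ht).not_ge ((mem_A.1 hvA).trans (mem_B.1 hvB))
  have hvolAB : G.vol A ≤ G.vol B :=
    calc G.vol A ≤ G.vol {v | 0 < g v} :=
          G.vol_mono (Finset.monotone_filter_right _ fun v _ hv => ht.trans_le hv)
      _ ≤ G.vol {v | g v = 0} := hvol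
      _ ≤ G.vol B :=
          G.vol_mono (Finset.monotone_filter_right _ fun v _ hv => hv.trans_le (half_pos ht).le)
  have hB : B.Nonempty := by
    rw [Finset.nonempty_iff_ne_empty]
    intro h
    exact ((vol_pos hdeg hA).trans_le hvolAB).ne' (h ▸ Finset.sum_empty)
  refine ⟨A, B, hA, hB, hAB, hvolAB, ?_⟩
  have hReff : (t - t / 2 - 0) ^ 2 ≤ G.Reff A B * G.energy (band (t / 2) t ∘ g) :=
    hG.sq_sub_le_Reff_mul_energy hA hB hAB (fun v hv => band_eq_sub half_le (mem_A.1 hv))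
      fun v hv => band_eq_zero half_le (mem_B.1 hv)
  have hscaled := hReff.trans (mul_le_mul_of_nonneg_left hband (G.Reff_nonneg A B))
  have ht2 : 0 < t ^ 2 / 4 := by positivity
  refine le_of_mul_le_mul_right ?_ ht2
  linarith

section Nontrivial

variable [Nontrivial V]

theorem Connected.lam_mul_min_vol_mul_sq_sub_le (hG : G.Connected) {A B : Finset V}
    (hAB : Disjoint A B) {f : V → ℝ} {a b : ℝ} (hfA : ∀ v ∈ A, f v = a)
    (hfB : ∀ v ∈ B, f v = b) :
    G.lam * min (G.vol A) (G.vol B) * (a - b) ^ 2 ≤ 2 * G.energy f := by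
  obtain ⟨c, hc⟩ := hG.exists_lam_mul_degreeNormSq_sub_le_energy f
  have h := G.min_vol_mul_sq_sub_le_degreeNormSq hAB (f := fun v => f v - c)
    (fun v hv => congrArg (· - c) (hfA v hv)) (fun v hv => congrArg (· - c) (hfB v hv))
  rw [sub_sub_sub_cancel_right] at h
  calc G.lam * min (G.vol A) (G.vol B) * (a - b) ^ 2
      ≤ G.lam * (2 * G.degreeNormSq fun v => f v - c) := by
        rw [mul_assoc]
        exact mul_le_mul_of_nonneg_left h hG.lam_pos.le
    _ ≤ 2 * G.energy f := by linarith

theorem Connected.Reff_le (hG : G.Connected) {A B : Finset V} (hA : A.Nonempty)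
    (hB : B.Nonempty) (hAB : Disjoint A B) :
    G.Reff A B ≤ 2 / (G.lam * min (G.vol A) (G.vol B)) := by
  have hdeg := G.degree_pos hG
  obtain ⟨f, a, b, hfA, hfB, hdrop, henergy⟩ := G.exists_energy_eq_Reff hAB
  have h := hG.lam_mul_min_vol_mul_sq_sub_le hAB hfA hfB
  rw [hdrop, henergy] at h
  rw [le_div_iff₀' (mul_pos hG.lam_pos (lt_min (vol_pos hdeg hA) (vol_pos hdeg hB)))]
  rcases (G.Reff_nonneg A B).eq_or_lt with hR | hR
  · rw [← hR, mul_zero]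
    exact two_pos.le
  · exact le_of_mul_le_mul_right (by linarith) hR

theorem Connected.exists_one_div_le_Reff (hG : G.Connected) :
    ∃ A B : Finset V, A.Nonempty ∧ B.Nonempty ∧ Disjoint A B ∧
      1 / (16 * G.lam * min (G.vol A) (G.vol B)) ≤ G.Reff A B := by
  have hdeg := G.degree_pos hG
  have hlam := hG.lam_pos
  obtain ⟨f, hf⟩ := hG.exists_isEigenfunction_lam
  obtain ⟨g, hg, hne, henergy, hvol⟩ := hf.exists_energy_le_and_vol_pos_le hdeg hlam.ne'
  obtain ⟨A, B, hA, hB, hAB, hle, hReff⟩ :=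
    hG.exists_one_le_mul_vol_mul_Reff hdeg hlam.le hg hne henergy hvol
  have hvolA := vol_pos hdeg hA
  refine ⟨A, B, hA, hB, hAB, ?_⟩
  rwa [min_eq_left hle, div_le_iff₀' (by positivity)]

end Nontrivial

end WeightedGraph

theorem theorem3 {V : Type*} [Fintype V] [DecidableEq V] [Nontrivial V]
    (G : WeightedGraph V) (hG : G.Connected) :
    (∃ S₁ S₂ : Finset V, S₁.Nonempty ∧ S₂.Nonempty ∧ Disjoint S₁ S₂ ∧
      1 / (25600 * G.lam * min (G.vol S₁) (G.vol S₂)) ≤ G.Reff S₁ S₂) ∧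
    (∀ S₁' S₂' : Finset V, S₁'.Nonempty → S₂'.Nonempty → Disjoint S₁' S₂' →
      G.Reff S₁' S₂' ≤ 2 / (G.lam * min (G.vol S₁') (G.vol S₂'))) := by
  refine ⟨?_, fun A B hA hB hAB => hG.Reff_le hA hB hAB⟩
  obtain ⟨A, B, hA, hB, hAB, hReff⟩ := hG.exists_one_div_le_Reff
  have hdeg := G.degree_pos hG
  have hlam := hG.lam_pos
  have hmin : 0 < min (G.vol A) (G.vol B) :=
    lt_min (WeightedGraph.vol_pos hdeg hA) (WeightedGraph.vol_pos hdeg hB)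
  refine ⟨A, B, hA, hB, hAB, le_trans ?_ hReff⟩
  gcongr
  norm_num
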